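/- All maps are $C^\infty$; $I_1,I_2$ are open intervals of $\mathbb R$, $U_1,U_2$ are open subsets of $\mathbb R^s$, and $(\bar u_i,t_i)\in U_i\times I_i$ $(i=1,2)$. **Definitions.** (a) For a map $g_i$ from $U_i\times I_i$ to $\mathbb R^m$ put $\bar g_i(u,t)=(g_i(u,t),t)$. For set germs $Y_i,Z_i$ in $\mathbb R^m\times\mathbb R$ at $(y_i,t_i)$ we write $K(Y_1,Z_1;(y_1,t_1))=K(Y_2,Z_2;(y_2,t_2))$, and say that the two contacts are of the same type, if there is a diffeomorphism germ $\Phi:(\mathbb R^m\times\mathbb R,(y_1,t_1))\to(\mathbb R^m\times\mathbb R,(y_2,t_2))$ of the form $\Phi(y,t)=(\phi_1(y,t),\phi_2(t))$ such that $\Phi(Y_1)=Y_2$ and $\Phi(Z_1)=Z_2$ as set germs. (b) Function germs $h_i$ at $(\bar u_i,t_i)\in\mathbb R^s\times\mathbb R$ are $P$-$\mathcal K$-equivalent if there are a diffeomorphism germ $\Psi:(\mathbb R^s\times\mathbb R,(\bar u_1,t_1))\to(\mathbb R^s\times\mathbb R,(\bar u_2,t_2))$ of the form $\Psi(u,t)=(\psi_1(u,t),\psi_2(t))$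 and a smooth function germ $\lambda$ at $(\bar u_1,t_1)$ with $\lambda(\bar u_1,t_1)\neq0$ such that $h_2\circ\Psi=\lambda\cdot h_1$. (c) On $\mathbb R^{n+1}$ let $\langle x,y\rangle=-x_0y_0+\sum_{i=1}^nx_iy_i$, $e_0=(1,0,\dots,0)$, $LC^*=\{x\mid x_0\ne0,\ \langle x,x\rangle=0\}$, $HP(v,c)=\{x\mid\langle x,v\rangle=c\}$, and $\widetilde x=(1,x_1/x_0,\dots,x_n/x_0)$ if $x_0\neq0$. A world sheet is an embedding $X:U\times I\to\mathbb R^{n+1}$ such that the image $W$ is time-orientable, all tangent spaces $T_pW$ are Lorentz subspaces and every momentary space $\mathcal S_t=X(U\times\{t\})$ is spacelike. Let $n^T(u,t)$ be the unique vector of $T_pW$, $p=X(u,t)$, that is pseudo-orthogonal to $T_p\mathcal S_t$ and satisfies $\langle n^T,n^T\rangle=-1$ and $\langle n^T,e_0\rangle<0$. Let $N_1[\mathcal S_t]_p$ be the set of vectors $\xi$ pseudo-orthogonal to $T_p\mathcal S_t$ and to $n^T(u,t)$ with $\langle\xi,\xi\rangle=1$. For such $\xi$ let $L=\widetilde{n^T(u,t)+\xi}$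 and $\mathbb{LP}(\mathcal S_t)((u,t),\xi)=\langle X(u,t),L\rangle L$. If $v=\mathbb{LP}(\mathcal S_t)((u,t),\xi)$ lies in $LC^*$, i.e. $v\ne 0$, the tangent lightlike hyperplane is $TLP(\mathcal S_t,v,\xi)=HP(\widetilde v,v_0)$. For $v\in LC^*$ put $\widetilde h_v(u,t)=\langle X(u,t),\widetilde v\rangle-v_0$. **Parametric Montaldi theorem.** Let $g_i:U_i\times I_i\to\mathbb R^m$ be such that every $u\mapsto g_i(u,t)$ is an immersion and $\bar g_i$ is a homeomorphism onto its image $\overline Y_i=\bar g_i(U_i\times I_i)$; put $y_i=g_i(\bar u_i,t_i)$, and let $f_i:(\mathbb R^m,y_i)\to(\mathbb R,0)$ be submersion germs with zero sets $V(f_i)$. Then $$K(\overline Y_1,V(f_1)\times I_1;(y_1,t_1))=K(\overline Y_2,V(f_2)\times I_2;(y_2,t_2))$$ if and only if $f_1\circ g_1$ at $(\bar u_1,t_1)$ and $f_2\circ g_2$ at $(\bar u_2,t_2)$ are $P$-$\mathcal K$-equivalent. **World sheets.** Let $X_i:U_i\times I_i\to\mathbb R^{n+1}$ be world sheets, $p_i=X_i(\bar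 u_i,t_i)$, $\xi_i\in N_1[\mathcal S_{t_i}]_{p_i}$, and suppose that $v_i=\mathbb{LP}(\mathcal S_{t_i})((\bar u_i,t_i),\xi_i)$ lies in $LC^*$ $(i=1,2)$. Let $\overline W_i=\{(X_i(u,t),t)\mid(u,t)\in U_i\times I_i\}$. Then $$K(\overline W_1,TLP(\mathcal S_{t_1},v_1,\xi_1)\times I_1;(p_1,t_1))=K(\overline W_2,TLP(\mathcal S_{t_2},v_2,\xi_2)\times I_2;(p_2,t_2))$$ if and only if $\widetilde h_{1,v_1}$ at $(\bar u_1,t_1)$ and $\widetilde h_{2,v_2}$ at $(\bar u_2,t_2)$ are $P$-$\mathcal K$-equivalent. -/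

import Mathlib

open Set Filter Topology
open scoped ContDiff

noncomputable section

/-! ### Germs of diffeomorphisms, contact and `P`-`𝒦`-equivalence -/

/-- `Φ` represents a smooth diffeomorphism germ `(E × ℝ, a) → (E × ℝ, b)` of the form
`Φ (x, t) = (φ₁ (x, t), φ₂ t)`. -/
structure IsParamDiffeoGerm {E : Type*} [NormedAddCommGroup E] [NormedSpace ℝ E]
    (Φ : OpenPartialHomeomorph (E × ℝ) (E × ℝ)) (a b : E × ℝ) : Prop where
  mem_source : a ∈ Φ.source
  map_base : Φ a = b
  smooth : ContDiffOn ℝ ∞ Φ Φ.source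
  smooth_symm : ContDiffOn ℝ ∞ Φ.symm Φ.target
  time : ∃ φ₂ : ℝ → ℝ, ∀ z ∈ Φ.source, (Φ z).2 = φ₂ z.2

/-- `K(Y₁, Z₁; a₁) = K(Y₂, Z₂; a₂)`: there is a diffeomorphism germ `Φ (y, t) = (φ₁ (y, t), φ₂ t)`
with `Φ a₁ = a₂` that maps the set germ `(Y₁, a₁)` onto `(Y₂, a₂)` and the set germ `(Z₁, a₁)`
onto `(Z₂, a₂)`. -/
def SameContactType {E : Type*} [NormedAddCommGroup E] [NormedSpace ℝ E]
    (Y₁ Z₁ : Set (E × ℝ)) (a₁ : E × ℝ) (Y₂ Z₂ : Set (E × ℝ)) (a₂ : E × ℝ) : Prop :=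
  ∃ Φ : OpenPartialHomeomorph (E × ℝ) (E × ℝ), IsParamDiffeoGerm Φ a₁ a₂ ∧
    (∀ᶠ z in 𝓝 a₁, z ∈ Y₁ ↔ Φ z ∈ Y₂) ∧ (∀ᶠ z in 𝓝 a₁, z ∈ Z₁ ↔ Φ z ∈ Z₂)

/-- `f` represents a smooth germ at `a`: it is smooth on a neighbourhood of `a`. -/
def IsSmoothGerm {E F : Type*} [NormedAddCommGroup E] [NormedSpace ℝ E]
    [NormedAddCommGroup F] [NormedSpace ℝ F] (f : E → F) (a : E) : Prop :=
  ∀ᶠ x in 𝓝 a, ContDiffAt ℝ ∞ f x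

/-- The function germs `h₁` at `q₁` and `h₂` at `q₂` are `P`-`𝒦`-equivalent:
`h₂ ∘ Ψ = l • h₁` near `q₁`, for a diffeomorphism germ `Ψ (u, t) = (ψ₁ (u, t), ψ₂ t)` with
`Ψ q₁ = q₂` and a smooth function germ `l` with `l q₁ ≠ 0`. -/
def PKEquivalent {E : Type*} [NormedAddCommGroup E] [NormedSpace ℝ E]
    (h₁ : E × ℝ → ℝ) (q₁ : E × ℝ) (h₂ : E × ℝ → ℝ) (q₂ : E × ℝ) : Prop :=
  ∃ (Ψ : OpenPartialHomeomorph (E × ℝ) (E × ℝ)) (l : E × ℝ → ℝ), IsParamDiffeoGerm Ψ q₁ q₂ ∧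
    IsSmoothGerm l q₁ ∧ l q₁ ≠ 0 ∧ ∀ᶠ q in 𝓝 q₁, h₂ (Ψ q) = l q * h₁ q

/-! ### One-parameter families of immersions -/

/-- The map `(u, t) ↦ (g (u, t), t)`. -/
def graphMap {E F : Type*} (g : E × ℝ → F) (q : E × ℝ) : F × ℝ := (g q, q.2)

/-- `g : U × I → ℝᵐ` is a smooth family, with parameter `t ∈ I` in an open interval, of immersions
`u ↦ g (u, t)`, and `(u, t) ↦ (g (u, t), t)` is a homeomorphism onto its image. -/
structure IsImmersedFamily {r m : ℕ} (U : Set (Fin r → ℝ)) (I : Set ℝ)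
    (g : (Fin r → ℝ) × ℝ → (Fin m → ℝ)) : Prop where
  isOpen_space : IsOpen U
  isOpen_time : IsOpen I
  interval : I.OrdConnected
  smooth : ContDiffOn ℝ ∞ g (U ×ˢ I)
  immersion : ∀ u ∈ U, ∀ t ∈ I, Function.Injective (fderiv ℝ (fun u' => g (u', t)) u)
  embedding : IsEmbedding ((U ×ˢ I).domRestrict (graphMap g))

/-- `f` represents a smooth submersion germ `(ℝᵐ, y) → (ℝ, 0)`. -/
structure IsSubmersionGerm {m : ℕ} (f : (Fin m → ℝ) → ℝ) (y : Fin m → ℝ) : Prop where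
  smooth : IsSmoothGerm f y
  map_base : f y = 0
  submersion : Function.Surjective (fderiv ℝ f y)

/-! ### Lorentz-Minkowski space -/

/-- The pseudo scalar product `-x₀ y₀ + ∑ xᵢ yᵢ` on `ℝⁿ⁺¹`. -/
def mink {n : ℕ} (x y : Fin (n + 1) → ℝ) : ℝ :=
  -(x 0 * y 0) + ∑ i : Fin n, x i.succ * y i.succ

/-- The future timelike vector `e₀ = (1, 0, …, 0)`. -/
def timeVec {n : ℕ} : Fin (n + 1) → ℝ := Pi.single 0 1

/-- A spacelike subspace: the pseudo scalar product is positive definite on it. -/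
def IsSpacelikeSubspace {n : ℕ} (S : Submodule ℝ (Fin (n + 1) → ℝ)) : Prop :=
  ∀ w ∈ S, w ≠ 0 → 0 < mink w w

/-- A timelike (Lorentz) subspace: the pseudo scalar product has signature `(-, +, …, +)` on it. -/
def IsTimelikeSubspace {n : ℕ} (S : Submodule ℝ (Fin (n + 1) → ℝ)) : Prop :=
  ∃ v ∈ S, mink v v < 0 ∧ ∀ w ∈ S, mink v w = 0 → w ≠ 0 → 0 < mink w w

/-- The hyperplane `HP(v, c)` with pseudo normal `v`. -/
def hyperplane {n : ℕ} (v : Fin (n + 1) → ℝ) (c : ℝ) : Set (Fin (n + 1) → ℝ) :=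
  {x | mink x v = c}

/-- The open lightcone `LC*`. -/
def lightcone (n : ℕ) : Set (Fin (n + 1) → ℝ) := {x | x 0 ≠ 0 ∧ mink x x = 0}

/-- The normalization `x̃ = (1, x₁ / x₀, …, xₙ / x₀)`, for `x₀ ≠ 0`. -/
def normalized {n : ℕ} (x : Fin (n + 1) → ℝ) : Fin (n + 1) → ℝ :=
  Fin.cons 1 fun i : Fin n => x i.succ / x 0

/-! ### World sheets -/

/-- The tangent space of `W = X (U × I)` at `X q`. -/
def tangentSheet {s n : ℕ} (X : (Fin s → ℝ) × ℝ → (Fin (n + 1) → ℝ)) (q : (Fin s → ℝ) × ℝ) :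
    Submodule ℝ (Fin (n + 1) → ℝ) :=
  LinearMap.range (fderiv ℝ X q).toLinearMap

/-- The tangent space of the momentary space `S_t = X (U × {t})` at `X (u, t)`, spanned by the
partial derivatives of `X` along the coordinates of `u`. -/
def tangentMomentary {s n : ℕ} (X : (Fin s → ℝ) × ℝ → (Fin (n + 1) → ℝ)) (q : (Fin s → ℝ) × ℝ) :
    Submodule ℝ (Fin (n + 1) → ℝ) :=
  LinearMap.range ((fderiv ℝ X q).toLinearMap ∘ₗ LinearMap.inl ℝ (Fin s → ℝ) ℝ)

/-- `X : U × I → ℝⁿ⁺¹₁` is a world sheet: a smooth timelike embedding with time-orientable image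
all of whose momentary spaces are spacelike. -/
structure IsWorldSheet {s n : ℕ} (U : Set (Fin s → ℝ)) (I : Set ℝ)
    (X : (Fin s → ℝ) × ℝ → (Fin (n + 1) → ℝ)) : Prop where
  isOpen_space : IsOpen U
  isOpen_time : IsOpen I
  interval : I.OrdConnected
  smooth : ContDiffOn ℝ ∞ X (U ×ˢ I)
  immersion : ∀ q ∈ U ×ˢ I, Function.Injective (fderiv ℝ X q)
  embedding : IsEmbedding ((U ×ˢ I).domRestrict X)
  timelike : ∀ q ∈ U ×ˢ I, IsTimelikeSubspace (tangentSheet X q)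
  spacelike : ∀ q ∈ U ×ˢ I, IsSpacelikeSubspace (tangentMomentary X q)
  timeOrientable : ∃ τ : (Fin s → ℝ) × ℝ → (Fin (n + 1) → ℝ), ContDiffOn ℝ ∞ τ (U ×ˢ I) ∧
    ∀ q ∈ U ×ˢ I, τ q ∈ tangentSheet X q ∧ mink (τ q) (τ q) < 0

/-- `ν` is a future directed timelike unit vector at `X q`, tangent to `W` and pseudo-normal to the
momentary space. -/
structure IsFutureNormal {s n : ℕ} (X : (Fin s → ℝ) × ℝ → (Fin (n + 1) → ℝ))
    (q : (Fin s → ℝ) × ℝ) (ν : Fin (n + 1) → ℝ) : Prop where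
  tangent : ν ∈ tangentSheet X q
  normal : ∀ w ∈ tangentMomentary X q, mink w ν = 0
  unit : mink ν ν = -1
  future : mink ν timeVec < 0

/-- The vector `nᵀ(u, t)`: the vector `ν` with `IsFutureNormal X (u, t) ν`, which exists and is
unique for a world sheet (see `IsWorldSheet.existsUnique_futureNormal`). -/
def futureNormal {s n : ℕ} (X : (Fin s → ℝ) × ℝ → (Fin (n + 1) → ℝ)) (q : (Fin s → ℝ) × ℝ) :
    Fin (n + 1) → ℝ :=
  Classical.epsilon (IsFutureNormal X q)

/-- The fibre `N₁[S_t]_p` at `p = X (u, t)`: the unit spacelike pseudo-normal vectors of `S_t` that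
are pseudo-orthogonal to `nᵀ(u, t)`. -/
def unitNormals {s n : ℕ} (X : (Fin s → ℝ) × ℝ → (Fin (n + 1) → ℝ)) (q : (Fin s → ℝ) × ℝ) :
    Set (Fin (n + 1) → ℝ) :=
  {ξ | (∀ w ∈ tangentMomentary X q, mink w ξ = 0) ∧ mink ξ ξ = 1 ∧ mink ξ (futureNormal X q) = 0}

/-- The normalized momentary lightcone Gauss map: the normalization of `nᵀ(u, t) + ξ`. -/
def lightconeGauss {s n : ℕ} (X : (Fin s → ℝ) × ℝ → (Fin (n + 1) → ℝ)) (q : (Fin s → ℝ) × ℝ)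
    (ξ : Fin (n + 1) → ℝ) : Fin (n + 1) → ℝ :=
  normalized (futureNormal X q + ξ)

/-- The momentary lightcone pedal map `LP(S_t)((u, t), ξ)`. -/
def lightconePedal {s n : ℕ} (X : (Fin s → ℝ) × ℝ → (Fin (n + 1) → ℝ)) (q : (Fin s → ℝ) × ℝ)
    (ξ : Fin (n + 1) → ℝ) : Fin (n + 1) → ℝ :=
  mink (X q) (lightconeGauss X q ξ) • lightconeGauss X q ξ

/-- The tangent lightlike hyperplane `TLP(S_t, v, ξ) = HP(ṽ, v₀)`, where
`v = LP(S_t)((u, t), ξ)`. -/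
def tangentLightlikeHyperplane {s n : ℕ} (X : (Fin s → ℝ) × ℝ → (Fin (n + 1) → ℝ))
    (q : (Fin s → ℝ) × ℝ) (ξ : Fin (n + 1) → ℝ) : Set (Fin (n + 1) → ℝ) :=
  hyperplane (normalized (lightconePedal X q ξ)) (lightconePedal X q ξ 0)

/-- The extended lightcone height function `h̃_v (u, t) = ⟨X (u, t), ṽ⟩ - v₀`. -/
def extendedHeight {s n : ℕ} (X : (Fin s → ℝ) × ℝ → (Fin (n + 1) → ℝ)) (v : Fin (n + 1) → ℝ)
    (q : (Fin s → ℝ) × ℝ) : ℝ :=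
  mink (X q) (normalized v) - v 0

theorem mink_add_left {n : ℕ} (x y z : Fin (n + 1) → ℝ) : mink (x + y) z = mink x z + mink y z := by
  simp only [mink, Pi.add_apply, add_mul, Finset.sum_add_distrib]; ring

theorem mink_smul_left {n : ℕ} (c : ℝ) (x z : Fin (n + 1) → ℝ) : mink (c • x) z = c * mink x z := by
  simp only [mink, Pi.smul_apply, smul_eq_mul, mul_assoc, ← Finset.mul_sum]; ring

theorem mink_comm {n : ℕ} (x y : Fin (n + 1) → ℝ) : mink x y = mink y x := by
  simp only [mink, mul_comm]

/-- The pseudo scalar product as a bilinear form. -/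
def minkForm (n : ℕ) : LinearMap.BilinForm ℝ (Fin (n + 1) → ℝ) :=
  LinearMap.mk₂ ℝ mink mink_add_left mink_smul_left
    (fun x y z => by rw [mink_comm, mink_add_left, mink_comm y, mink_comm z])
    (fun c x z => by rw [mink_comm, mink_smul_left, mink_comm z]; rfl)

/-- Pseudo-orthogonal projection to a spacelike subspace. -/
theorem IsSpacelikeSubspace.exists_proj {n : ℕ} {S : Submodule ℝ (Fin (n + 1) → ℝ)}
    (hS : IsSpacelikeSubspace S) (v : Fin (n + 1) → ℝ) :
    ∃ w ∈ S, ∀ x ∈ S, mink x (v - w) = 0 := by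
  have hsymm : (minkForm n).IsRefl := fun x y h => by
    change mink y x = 0; rw [mink_comm]; exact h
  have hnd : ((minkForm n).restrict S).Nondegenerate := by
    refine (LinearMap.IsRefl.nondegenerate_iff_separatingLeft ?_).2 ?_
    · intro x y h; exact hsymm _ _ h
    · intro x hx
      by_contra hne
      have h1 := hS x x.2 (fun h => hne (Subtype.ext h))
      have h2 : mink (x : Fin (n + 1) → ℝ) x = 0 := hx x
      linarith
  have hc := LinearMap.BilinForm.isCompl_orthogonal_of_restrict_nondegenerate hsymm hnd
  have hv : v ∈ S ⊔ (minkForm n).orthogonal S := by rw [hc.sup_eq_top]; trivial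
  obtain ⟨w, hw, m, hm, rfl⟩ := Submodule.mem_sup.1 hv
  refine ⟨w, hw, fun x hx => ?_⟩
  rw [add_sub_cancel_left]
  exact hm x hx

theorem tangentMomentary_le {s n : ℕ} (X : (Fin s → ℝ) × ℝ → (Fin (n + 1) → ℝ))
    (q : (Fin s → ℝ) × ℝ) : tangentMomentary X q ≤ tangentSheet X q :=
  LinearMap.range_comp_le_range _ _

theorem mink_self_timeVec {n : ℕ} (x : Fin (n + 1) → ℝ) : mink x timeVec = -x 0 := by
  simp [mink, timeVec, Fin.succ_ne_zero]

theorem head_ne_zero_of_mink_neg {n : ℕ} {x : Fin (n + 1) → ℝ} (h : mink x x < 0) : x 0 ≠ 0 := by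
  intro h0
  have : 0 ≤ ∑ i : Fin n, x i.succ * x i.succ := Finset.sum_nonneg fun i _ => mul_self_nonneg _
  simp only [mink, h0] at h
  linarith

/-- For a world sheet the future directed timelike unit normal of the momentary space that is
tangent to `W` exists and is unique. -/
theorem IsWorldSheet.existsUnique_futureNormal {s n : ℕ} {U : Set (Fin s → ℝ)} {I : Set ℝ}
    {X : (Fin s → ℝ) × ℝ → (Fin (n + 1) → ℝ)} (hX : IsWorldSheet U I X) {q : (Fin s → ℝ) × ℝ}
    (hq : q ∈ U ×ˢ I) : ∃! ν, IsFutureNormal X q ν := by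
  obtain ⟨v, hvT, hv, -⟩ := hX.timelike q hq
  have hS := hX.spacelike q hq
  obtain ⟨w, hwS, hw⟩ := hS.exists_proj v
  obtain ⟨m, hm⟩ : ∃ m, m = v - w := ⟨_, rfl⟩
  have hvm : v = w + m := by rw [hm]; abel
  rw [← hm] at hw
  have hmT : m ∈ tangentSheet X q := hm ▸ Submodule.sub_mem _ hvT (tangentMomentary_le X q hwS)
  have hmm : mink m m < 0 := by
    have h1 : mink v v = mink w w + mink m m := by
      have h2 := hw w hwS
      rw [hvm, mink_add_left, mink_comm w, mink_comm m, mink_add_left, mink_add_left,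
        mink_comm m w, h2]; ring
    have h3 : 0 ≤ mink w w := by
      by_cases h0 : w = 0
      · simp [h0, mink]
      · exact (hS w hwS h0).le
    linarith
  have hm0 := head_ne_zero_of_mink_neg hmm
  -- the normalization of `m`
  have hex : ∃ c : ℝ, c * c * mink m m = -1 ∧ 0 < c * m 0 := by
    have hs : 0 < √(-mink m m) := Real.sqrt_pos.2 (by linarith)
    have hs2 : √(-mink m m) * √(-mink m m) = -mink m m := Real.mul_self_sqrt (by linarith)
    have key : (√(-mink m m))⁻¹ * (√(-mink m m))⁻¹ * mink m m = -1 := by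
      rw [← mul_inv, hs2, inv_neg, neg_mul, inv_mul_cancel₀ hmm.ne]
    rcases lt_or_gt_of_ne hm0 with h | h
    · exact ⟨-(√(-mink m m))⁻¹, by rw [neg_mul_neg, key],
        mul_pos_of_neg_of_neg (neg_neg_of_pos (inv_pos.2 hs)) h⟩
    · exact ⟨(√(-mink m m))⁻¹, key, mul_pos (inv_pos.2 hs) h⟩
  obtain ⟨c, hc1, hc0⟩ := hex
  have hν : IsFutureNormal X q (c • m) := by
    refine ⟨Submodule.smul_mem _ _ hmT, fun x hx => ?_, ?_, ?_⟩
    · rw [mink_comm, mink_smul_left, mink_comm, hw x hx, mul_zero]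
    · rw [mink_smul_left, mink_comm, mink_smul_left, ← mul_assoc, hc1]
    · rw [mink_self_timeVec]
      simpa using hc0
  refine ⟨c • m, hν, fun ν h => ?_⟩
  generalize c • m = μ at hν
  -- `μ` and `ν` are proportional modulo the momentary tangent space
  obtain ⟨⟨a, τ⟩, ha⟩ := hν.tangent
  obtain ⟨⟨b, σ⟩, hb⟩ := h.tangent
  have hτ : τ ≠ 0 := by
    rintro rfl
    have hμS : μ ∈ tangentMomentary X q := ⟨a, ha⟩
    have h1 := hν.normal μ hμS
    have h2 := hν.unit
    linarith
  have hd : ν - (σ / τ) • μ ∈ tangentMomentary X q := by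
    refine ⟨b - (σ / τ) • a, ?_⟩
    rw [← ha, ← hb, ← map_smul, ← map_sub]
    simp [hτ]
  have hd0 : ν - (σ / τ) • μ = 0 := by
    by_contra hne
    have h1 := hS _ hd hne
    have h2 : mink (ν - (σ / τ) • μ) (ν - (σ / τ) • μ) = 0 := by
      nth_rw 2 [sub_eq_add_neg]
      rw [← neg_smul, mink_comm, mink_add_left, mink_smul_left, mink_comm, h.normal _ hd, mink_comm μ,
        hν.normal _ hd]
      ring
    linarith
  have hνμ : ν = (σ / τ) • μ := sub_eq_zero.1 hd0
  generalize σ / τ = k at hνμ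
  have hk : k * k = 1 := by
    have h1 := h.unit
    rw [hνμ, mink_smul_left, mink_comm, mink_smul_left, hν.unit] at h1
    linarith
  have hkpos : 0 < k := by
    have h1 := h.future
    have h2 := hν.future
    rw [hνμ, mink_smul_left] at h1
    by_contra hk0
    nlinarith
  have : k = 1 := by nlinarith
  rw [hνμ, this, one_smul]

theorem IsWorldSheet.isFutureNormal {s n : ℕ} {U : Set (Fin s → ℝ)} {I : Set ℝ}
    {X : (Fin s → ℝ) × ℝ → (Fin (n + 1) → ℝ)} (hX : IsWorldSheet U I X) {q : (Fin s → ℝ) × ℝ}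
    (hq : q ∈ U ×ˢ I) : IsFutureNormal X q (futureNormal X q) :=
  Classical.epsilon_spec (hX.existsUnique_futureNormal hq).exists

end

/-!
Let `F₁` and `F₂` be equations of the sets with which the graphs are in contact, and `h₁` and `h₂`
their restrictions to the graphs. In both directions the graphs are first straightened: an immersed
family extends to a diffeomorphism germ that carries the zero section of a trivial bundle over the
parameter space to the graph and preserves `t`. A contact equivalence `Φ` then restricts to the zero
section, and Hadamard's lemma provides the factor `l`, because `F₁` and `F₂ ∘ Φ` are submersions
with the same zero set.

Conversely, a `P`-`𝒦`-equivalence `h₂ ∘ Ψ = l h₁` on the zero section is extended by the identity of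
the fibres. Then `l F₁` and `F₂ ∘ Ψ` are two submersions which agree on the zero section. They are
submersions on time slices, so some direction `e` within the slice is transverse to both zero sets,
and with a linear form `L` such that `L e = 1` the shears `z ↦ z + (F z - L z) e` make both of them
equal to `L`. The quotient of the two shears carries one function to the other, preserves `t`, and
fixes every point at which the functions agree, in particular the zero section.
-/

/-! ### Smooth germs -/

section Germs

variable {A B C : Type*} [NormedAddCommGroup A] [NormedSpace ℝ A] [NormedAddCommGroup B]
  [NormedSpace ℝ B] [NormedAddCommGroup C] [NormedSpace ℝ C]

namespace IsSmoothGerm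

theorem of_contDiff {f : A → B} (hf : ContDiff ℝ ∞ f) (a : A) : IsSmoothGerm f a :=
  Eventually.of_forall fun _ => hf.contDiffAt

theorem of_contDiffOn {f : A → B} {s : Set A} (hf : ContDiffOn ℝ ∞ f s) (hs : IsOpen s) {a : A}
    (ha : a ∈ s) : IsSmoothGerm f a := by
  filter_upwards [hs.mem_nhds ha] with x hx using hf.contDiffAt (hs.mem_nhds hx)

theorem contDiffAt {f : A → B} {a : A} (hf : IsSmoothGerm f a) : ContDiffAt ℝ ∞ f a :=
  hf.self_of_nhds

theorem differentiableAt {f : A → B} {a : A} (hf : IsSmoothGerm f a) : DifferentiableAt ℝ f a :=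
  hf.contDiffAt.differentiableAt (by simp)

theorem hasFDerivAt {f : A → B} {a : A} (hf : IsSmoothGerm f a) :
    HasFDerivAt f (fderiv ℝ f a) a :=
  hf.differentiableAt.hasFDerivAt

theorem continuousAt {f : A → B} {a : A} (hf : IsSmoothGerm f a) : ContinuousAt f a :=
  hf.contDiffAt.continuousAt

theorem comp {g : B → C} {f : A → B} {a : A} (hg : IsSmoothGerm g (f a)) (hf : IsSmoothGerm f a) :
    IsSmoothGerm (g ∘ f) a := by
  filter_upwards [hf.continuousAt.eventually hg, hf] with x hgx hfx using hgx.comp x hfx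

theorem prodMk {f : A → B} {g : A → C} {a : A} (hf : IsSmoothGerm f a) (hg : IsSmoothGerm g a) :
    IsSmoothGerm (fun x => (f x, g x)) a := by
  filter_upwards [hf, hg] with x hfx hgx using hfx.prodMk hgx

theorem add {f g : A → B} {a : A} (hf : IsSmoothGerm f a) (hg : IsSmoothGerm g a) :
    IsSmoothGerm (f + g) a := by
  filter_upwards [hf, hg] with x hfx hgx using hfx.add hgx

theorem sub {f g : A → B} {a : A} (hf : IsSmoothGerm f a) (hg : IsSmoothGerm g a) :
    IsSmoothGerm (f - g) a := by
  filter_upwards [hf, hg] with x hfx hgx using hfx.sub hgx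

theorem smul {f : A → ℝ} {g : A → B} {a : A} (hf : IsSmoothGerm f a) (hg : IsSmoothGerm g a) :
    IsSmoothGerm (f • g) a := by
  filter_upwards [hf, hg] with x hfx hgx using hfx.smul hgx

theorem exists_contDiff [HasContDiffBump A] {f : A → B} {a : A} (hf : IsSmoothGerm f a) :
    ∃ g : A → B, ContDiff ℝ ∞ g ∧ g =ᶠ[𝓝 a] f := by
  obtain ⟨ε, hε, hfε⟩ := Metric.nhds_basis_closedBall.eventually_iff.1 hf
  let χ : ContDiffBump a := ⟨ε / 2, ε, half_pos hε, half_lt_self hε⟩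
  refine ⟨fun x => χ x • f x, contDiff_iff_contDiffAt.2 fun x => ?_, ?_⟩
  · by_cases hx : x ∈ Metric.closedBall a ε
    · exact χ.contDiffAt.smul (hfε hx)
    · refine (contDiffAt_const (c := (0 : B))).congr_of_eventuallyEq ?_
      filter_upwards [Metric.isClosed_closedBall.isOpen_compl.mem_nhds hx] with y hy
      rw [χ.zero_of_le_dist (le_of_not_ge hy), zero_smul]
  · filter_upwards [χ.eventuallyEq_one] with x hx
    rw [hx, Pi.one_apply, one_smul]

theorem fderiv_comp_fderiv_of_leftInverse {f : A → B} {g : B → A} {a : A} {b : B}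
    (hf : IsSmoothGerm f a) (hg : IsSmoothGerm g b) (hfa : f a = b) (hgf : g ∘ f =ᶠ[𝓝 a] id) :
    (fderiv ℝ g b).comp (fderiv ℝ f a) = ContinuousLinearMap.id ℝ A := by
  obtain rfl := hfa
  rw [← fderiv_comp a hg.differentiableAt hf.differentiableAt, hgf.fderiv_eq, fderiv_id]

theorem bijective_fderiv_of_inverse {f : A → B} {g : B → A} {a : A} {b : B}
    (hf : IsSmoothGerm f a) (hg : IsSmoothGerm g b) (hfa : f a = b) (hgf : g ∘ f =ᶠ[𝓝 a] id)
    (hfg : f ∘ g =ᶠ[𝓝 b] id) : Function.Bijective (fderiv ℝ f a) := by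
  have hgb : g b = a := hfa ▸ hgf.self_of_nhds
  exact Function.bijective_iff_has_inverse.2 ⟨fderiv ℝ g b,
    DFunLike.congr_fun (hf.fderiv_comp_fderiv_of_leftInverse hg hfa hgf),
    DFunLike.congr_fun (hg.fderiv_comp_fderiv_of_leftInverse hf hgb hfg)⟩

end IsSmoothGerm

/-- `Φ` represents a smooth diffeomorphism germ `(A, a) → (B, b)`. -/
structure IsDiffeoGerm (Φ : OpenPartialHomeomorph A B) (a : A) (b : B) : Prop where
  mem_source : a ∈ Φ.source
  map_base : Φ a = b
  smooth : ContDiffOn ℝ ∞ Φ Φ.source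
  smooth_symm : ContDiffOn ℝ ∞ Φ.symm Φ.target

namespace IsDiffeoGerm

variable {Φ : OpenPartialHomeomorph A B} {Θ : OpenPartialHomeomorph B C} {a : A} {b : B} {c : C}

theorem mem_target (h : IsDiffeoGerm Φ a b) : b ∈ Φ.target :=
  h.map_base ▸ Φ.map_source h.mem_source

theorem symm (h : IsDiffeoGerm Φ a b) : IsDiffeoGerm Φ.symm b a where
  mem_source := h.mem_target
  map_base := by rw [← h.map_base, Φ.left_inv h.mem_source]
  smooth := h.smooth_symm
  smooth_symm := by simpa using h.smooth

theorem trans (hΦ : IsDiffeoGerm Φ a b) (hΘ : IsDiffeoGerm Θ b c) :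
    IsDiffeoGerm (Φ.trans Θ) a c where
  mem_source := by simp [hΦ.mem_source, hΦ.map_base, hΘ.mem_source]
  map_base := by simp [hΦ.map_base, hΘ.map_base]
  smooth := by
    rw [Φ.trans_source]
    exact hΘ.smooth.comp (hΦ.smooth.mono inter_subset_left) fun x hx => hx.2
  smooth_symm := by
    rw [Φ.trans_target]
    exact hΦ.smooth_symm.comp (hΘ.smooth_symm.mono inter_subset_left) fun x hx => hx.2

theorem restrOpen (h : IsDiffeoGerm Φ a b) {s : Set A} (hs : IsOpen s) (ha : a ∈ s) :
    IsDiffeoGerm (Φ.restrOpen s hs) a b where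
  mem_source := ⟨h.mem_source, ha⟩
  map_base := h.map_base
  smooth := h.smooth.mono inter_subset_left
  smooth_symm := h.smooth_symm.mono inter_subset_left

theorem isSmoothGerm (h : IsDiffeoGerm Φ a b) : IsSmoothGerm Φ a :=
  .of_contDiffOn h.smooth Φ.open_source h.mem_source

theorem isSmoothGerm_comp (h : IsDiffeoGerm Φ a b) {f : B → C} (hf : IsSmoothGerm f b) :
    IsSmoothGerm (f ∘ Φ) a :=
  .comp (h.map_base ▸ hf) h.isSmoothGerm

theorem tendsto (h : IsDiffeoGerm Φ a b) : Tendsto Φ (𝓝 a) (𝓝 b) :=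
  h.map_base ▸ h.isSmoothGerm.continuousAt.tendsto

theorem eventually_mem_source (h : IsDiffeoGerm Φ a b) : ∀ᶠ x in 𝓝 a, x ∈ Φ.source :=
  Φ.open_source.mem_nhds h.mem_source

theorem fderiv_comp (h : IsDiffeoGerm Φ a b) {f : B → C} (hf : IsSmoothGerm f b) :
    fderiv ℝ (f ∘ Φ) a = (fderiv ℝ f b).comp (fderiv ℝ Φ a) := by
  obtain rfl := h.map_base
  exact _root_.fderiv_comp a hf.differentiableAt h.isSmoothGerm.differentiableAt

theorem bijective_fderiv (h : IsDiffeoGerm Φ a b) : Function.Bijective (fderiv ℝ Φ a) :=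
  h.isSmoothGerm.bijective_fderiv_of_inverse h.symm.isSmoothGerm h.map_base
    (h.eventually_mem_source.mono fun _ => Φ.left_inv)
    (h.symm.eventually_mem_source.mono fun _ => Φ.right_inv)

theorem eventuallyEq_comp_symm {α : Type*} {f : A → α} {g : B → α} (h : IsDiffeoGerm Φ a b)
    (hfg : f =ᶠ[𝓝 a] g ∘ Φ) : g =ᶠ[𝓝 b] f ∘ Φ.symm := by
  filter_upwards [h.symm.tendsto.eventually hfg, h.symm.eventually_mem_source] with y hy hy_target
  simpa [Φ.right_inv hy_target] using hy.symm

theorem prod_refl (h : IsDiffeoGerm Φ a b) (c : C) :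
    IsDiffeoGerm (Φ.prod (.refl C)) (a, c) (b, c) where
  mem_source := ⟨h.mem_source, mem_univ c⟩
  map_base := Prod.ext h.map_base rfl
  smooth := h.smooth.prodMap contDiffOn_id
  smooth_symm := h.smooth_symm.prodMap contDiffOn_id

end IsDiffeoGerm

theorem IsSmoothGerm.exists_isDiffeoGerm [CompleteSpace A] [CompleteSpace B] {f : A → B} {a : A}
    (hf : IsSmoothGerm f a) (hbij : Function.Bijective (fderiv ℝ f a)) :
    ∃ Φ : OpenPartialHomeomorph A B, IsDiffeoGerm Φ a (f a) ∧ (Φ : A → B) = f := by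
  let L : A ≃L[ℝ] B := .ofBijective (fderiv ℝ f a) (LinearMap.ker_eq_bot.2 hbij.1)
    (LinearMap.range_eq_top.2 hbij.2)
  have hL : (L : A →L[ℝ] B) = fderiv ℝ f a := ContinuousLinearEquiv.coe_ofBijective ..
  have hfL : HasFDerivAt f (L : A →L[ℝ] B) a := hL ▸ hf.hasFDerivAt
  have hinv : ∀ᶠ x in 𝓝 a, ∃ e : A ≃L[ℝ] B, (e : A →L[ℝ] B) = fderiv ℝ f x := by
    have hcont : ContinuousAt (fderiv ℝ f) a :=
      (hf.contDiffAt.fderiv_right (m := 0) (by simp)).continuousAt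
    exact hcont.eventually (hL ▸ ContinuousLinearEquiv.nhds L)
  obtain ⟨s, hs, hso, has⟩ := eventually_nhds_iff.1 (hf.and hinv)
  let Θ := hf.contDiffAt.toOpenPartialHomeomorph f hfL (by simp)
  refine ⟨Θ.restrOpen s hso, ⟨?_, rfl, fun x hx => ?_, fun y hy => ?_⟩, rfl⟩
  · exact ⟨hf.contDiffAt.mem_toOpenPartialHomeomorph_source hfL (by simp), has⟩
  · exact (hs x hx.2).1.contDiffWithinAt
  · obtain ⟨hsmooth, e, he⟩ := hs _ hy.2
    have hderiv : HasFDerivAt Θ (e : A →L[ℝ] B) (Θ.symm y) :=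
      he ▸ (hsmooth.differentiableAt (by simp)).hasFDerivAt
    exact (Θ.contDiffAt_symm hy.1 hderiv hsmooth).contDiffWithinAt

/-! ### Hadamard's lemma -/

open MeasureTheory in
theorem contDiff_setIntegral_of_isCompact {G : Type*} [NormedAddCommGroup G] [NormedSpace ℝ G]
    [FiniteDimensional ℝ G] [MeasurableSpace G] [BorelSpace G] {μ : Measure G}
    [IsFiniteMeasureOnCompacts μ] {k : A × G → B} (hk : ContDiff ℝ ∞ k) {K : Set G}
    (hK : IsCompact K) : ContDiff ℝ ∞ fun x => ∫ r in K, k (x, r) ∂μ := by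
  obtain ⟨R, hR, hKR⟩ := hK.isBounded.subset_closedBall_lt 0 (0 : G)
  let χ : ContDiffBump (0 : G) := ⟨R, R + 1, hR, lt_add_one R⟩
  have hind : LocallyIntegrable (K.indicator fun _ => (1 : ℝ)) μ :=
    ((integrable_indicator_iff hK.measurableSet).2
      (integrableOn_const hK.measure_lt_top.ne)).locallyIntegrable
  have hconv := contDiffOn_convolution_right_with_param (n := ⊤) (ContinuousLinearMap.lsmul ℝ ℝ)
    (g := fun (x : A) (r : G) => χ r • k (x, -r)) isOpen_univ χ.hasCompactSupport
    (fun p r _ hr => by rw [image_eq_zero_of_notMem_tsupport hr, zero_smul]) hind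
    (ContDiff.contDiffOn ((χ.contDiff.comp contDiff_snd).smul
      (hk.comp (contDiff_fst.prodMk contDiff_snd.neg))))
  rw [univ_prod_univ, contDiffOn_univ] at hconv
  convert! hconv.comp (contDiff_id.prodMk (contDiff_const (c := (0 : G)))) using 2 with x
  rw [Function.comp_apply, convolution, ← integral_indicator hK.measurableSet]
  congr 1 with r
  by_cases hr : r ∈ K
  · have hχ : χ (-r) = 1 := χ.one_of_mem_closedBall (by simpa using hKR hr)
    simp [hr, hχ]
  · simp [hr]

theorem exists_contDiff_smul_eq_sub [CompleteSpace B] {G : A → B} (hG : ContDiff ℝ ∞ G) (e : A) :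
    ∃ μ : A × ℝ → B, ContDiff ℝ ∞ μ ∧ ∀ x c, G (x + c • e) - G x = c • μ (x, c) := by
  have hk : ContDiff ℝ ∞ fun p : (A × ℝ) × ℝ => fderiv ℝ G (p.1.1 + (p.2 * p.1.2) • e) e :=
    ((hG.fderiv_right (m := ∞) (by simp)).comp (by fun_prop)).clm_apply contDiff_const
  refine ⟨_, contDiff_setIntegral_of_isCompact (μ := MeasureTheory.volume) hk
    (isCompact_Icc (a := (0 : ℝ)) (b := 1)), fun x c => ?_⟩
  have hderiv (r : ℝ) : HasDerivAt (fun r : ℝ => G (x + r • e)) (fderiv ℝ G (x + r • e) e) r := by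
    have hline : HasDerivAt (fun r : ℝ => x + r • e) e r := by
      simpa using ((hasDerivAt_id r).smul_const e).const_add x
    exact (hG.differentiable (by simp) _).hasFDerivAt.comp_hasDerivAt r hline
  have hcont : Continuous fun r : ℝ => fderiv ℝ G (x + r • e) e :=
    ((hG.continuous_fderiv (by simp)).comp (by fun_prop)).clm_apply continuous_const
  have hint := intervalIntegral.integral_unitInterval_deriv_eq_sub (𝕜 := ℝ) (z₀ := 0) (z₁ := c)
    (f' := fun r => fderiv ℝ G (x + r • e) e) (f := fun r => G (x + r • e))
    (hcont.comp (by fun_prop)).continuousOn fun r _ => hderiv _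
  simp only [zero_add, zero_smul, add_zero, smul_eq_mul] at hint
  rw [← hint, intervalIntegral.integral_of_le zero_le_one,
    MeasureTheory.integral_Icc_eq_integral_Ioc]

/-- Since `l ∘ S = F`, the shear `S` straightens `F`. -/
theorem IsSmoothGerm.exists_shear [CompleteSpace A] {F : A → ℝ} {a e : A} {l : A →L[ℝ] ℝ}
    (hF : IsSmoothGerm F a) (hl : l e = 1) (he : fderiv ℝ F a e ≠ 0) :
    ∃ S : OpenPartialHomeomorph A A, IsDiffeoGerm S a (a + (F a - l a) • e) ∧
      ∀ z, S z = z + (F z - l z) • e := by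
  let D : A →L[ℝ] A := .id ℝ A + (fderiv ℝ F a - l).smulRight e
  have hshear : IsSmoothGerm (id + (F - l) • fun _ => e) a :=
    .add (.of_contDiff contDiff_id a)
      (.smul (hF.sub (.of_contDiff l.contDiff a)) (.of_contDiff contDiff_const a))
  have hD : HasFDerivAt (id + (F - l) • fun _ => e) D a :=
    (hasFDerivAt_id a).add ((hF.hasFDerivAt.sub l.hasFDerivAt).smul_const e)
  have hbij : Function.Bijective D := by
    refine Function.bijective_iff_has_inverse.2
      ⟨fun y => y - ((fderiv ℝ F a y - l y) / fderiv ℝ F a e) • e, fun x => ?_, fun y => ?_⟩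
    · have hDx : fderiv ℝ F a (D x) - l (D x) = (fderiv ℝ F a x - l x) * fderiv ℝ F a e := by
        simp only [D, add_apply, ContinuousLinearMap.id_apply, ContinuousLinearMap.smulRight_apply,
          sub_apply, map_add, map_smul, smul_eq_mul, hl]
        ring
      simp only [hDx, mul_div_cancel_right₀ _ he]
      simp [D]
    · simp [D, hl, he]
  obtain ⟨S, hS, hS_eq⟩ := hshear.exists_isDiffeoGerm (hD.fderiv ▸ hbij)
  exact ⟨S, hS, fun z => by rw [hS_eq]; rfl⟩

theorem IsSmoothGerm.exists_eq_smul [HasContDiffBump A] [CompleteSpace A] [CompleteSpace B]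
    {F : A → ℝ} {G : A → B} {a : A} (hF : IsSmoothGerm F a) (hG : IsSmoothGerm G a)
    (hFa : F a = 0) (hdF : fderiv ℝ F a ≠ 0) (hzero : ∀ᶠ z in 𝓝 a, F z = 0 → G z = 0) :
    ∃ μ : A → B, IsSmoothGerm μ a ∧ ∀ᶠ z in 𝓝 a, G z = F z • μ z := by
  obtain ⟨e, he⟩ : ∃ e, fderiv ℝ F a e ≠ 0 := by
    simpa using mt ContinuousLinearMap.ext hdF
  obtain ⟨l, hl⟩ := SeparatingDual.exists_eq_one (R := ℝ) (x := e) (by rintro rfl; simp at he)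
  obtain ⟨S, hS, hS_eq⟩ := hF.exists_shear hl he
  have hlS z : l (S z) = F z := by simp [hS_eq, hl]
  -- In the coordinates `S`, divide by `l`, along the lines with direction `e`.
  obtain ⟨H, hH, hHG⟩ := (hS.symm.isSmoothGerm_comp hG).exists_contDiff
  obtain ⟨ν, hν, hHν⟩ := exists_contDiff_smul_eq_sub hH e
  let P : A → A := fun z => z - l z • e
  have hSP z : S z = P z + F z • e := by rw [hS_eq]; simp only [P]; module
  have hP : ContDiff ℝ ∞ P := contDiff_id.sub (l.contDiff.smul contDiff_const)
  have hPa : P a = a + (F a - l a) • e := by simp [P, hFa, sub_eq_add_neg]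
  have hPt : Tendsto P (𝓝 a) (𝓝 (a + (F a - l a) • e)) := hPa ▸ hP.continuous.tendsto a
  refine ⟨fun z => ν (P z, F z), ?_, ?_⟩
  · exact .comp (.of_contDiff hν _) ((IsSmoothGerm.of_contDiff hP a).prodMk hF)
  filter_upwards [hS.tendsto.eventually hHG, hS.eventually_mem_source, hPt.eventually hHG,
    hPt.eventually hS.symm.eventually_mem_source,
    hPt.eventually (hS.symm.tendsto.eventually hzero)] with z hz hz_source hPz hPz_target hPz_zero
  have hFP : F (S.symm (P z)) = 0 := by
    rw [← hlS, S.right_inv hPz_target]; simp [P, hl]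
  rw [Function.comp_apply, S.left_inv hz_source] at hz
  rw [Function.comp_apply, hPz_zero hFP] at hPz
  rw [← hz, hSP, ← hHν, hPz, sub_zero]

end Germs

/-! ### Germs preserving a factor of a product -/

section Product

variable {A B W W' : Type*} [NormedAddCommGroup A] [NormedSpace ℝ A] [NormedAddCommGroup B]
  [NormedSpace ℝ B] [NormedAddCommGroup W] [NormedSpace ℝ W] [NormedAddCommGroup W']
  [NormedSpace ℝ W'] {Ω : OpenPartialHomeomorph (A × W) (B × W')} {a : A} {b : B}

namespace IsDiffeoGerm

theorem isSmoothGerm_fst_comp_prodMk_zero (hΩ : IsDiffeoGerm Ω (a, 0) (b, 0)) :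
    IsSmoothGerm (fun x => (Ω (x, 0)).1) a :=
  .comp (.of_contDiff contDiff_fst _)
    (.comp hΩ.isSmoothGerm (.of_contDiff (contDiff_prodMk_left 0) a))

theorem eventually_prodMk_zero_eq (hΩ : IsDiffeoGerm Ω (a, 0) (b, 0))
    (hzero : {z | z.2 = 0} =ᶠ[𝓝 (a, 0)] Ω ⁻¹' {z | z.2 = 0}) :
    ∀ᶠ x in 𝓝 a, Ω (x, 0) = ((Ω (x, 0)).1, 0) ∧ (Ω.symm ((Ω (x, 0)).1, 0)).1 = x := by
  have hinl : Tendsto (fun x : A => (x, (0 : W))) (𝓝 a) (𝓝 (a, 0)) :=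
    (Continuous.prodMk_left 0).tendsto a
  filter_upwards [hinl.eventually (eventuallyEq_set.1 hzero),
    hinl.eventually hΩ.eventually_mem_source] with x hx hx_source
  have hΩx : Ω (x, 0) = ((Ω (x, 0)).1, 0) := Prod.ext rfl (hx.1 rfl)
  exact ⟨hΩx, by rw [← hΩx, Ω.left_inv hx_source]⟩

theorem exists_restrict [CompleteSpace A] [CompleteSpace B] (hΩ : IsDiffeoGerm Ω (a, 0) (b, 0))
    (hzero : {z | z.2 = 0} =ᶠ[𝓝 (a, 0)] Ω ⁻¹' {z | z.2 = 0}) :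
    ∃ Ψ : OpenPartialHomeomorph A B, IsDiffeoGerm Ψ a b ∧ ∀ᶠ x in 𝓝 a, Ω (x, 0) = (Ψ x, 0) := by
  have hbase : (Ω (a, 0)).1 = b := congrArg Prod.fst hΩ.map_base
  have hinv := hΩ.eventually_prodMk_zero_eq hzero
  have hinv_symm := hΩ.symm.eventually_prodMk_zero_eq (hΩ.eventuallyEq_comp_symm hzero)
  obtain ⟨Ψ, hΨ, hΨ_eq⟩ := hΩ.isSmoothGerm_fst_comp_prodMk_zero.exists_isDiffeoGerm
    (hΩ.isSmoothGerm_fst_comp_prodMk_zero.bijective_fderiv_of_inverse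
      hΩ.symm.isSmoothGerm_fst_comp_prodMk_zero hbase (hinv.mono fun _ h => h.2)
      (hinv_symm.mono fun _ h => h.2))
  exact ⟨Ψ, hbase ▸ hΨ, hinv.mono fun x hx => hΨ_eq ▸ hx.1⟩

end IsDiffeoGerm

end Product

/-! ### Germs on spaces with a time function -/

section Time

variable {A B : Type*} [NormedAddCommGroup A] [NormedSpace ℝ A] [NormedAddCommGroup B]
  [NormedSpace ℝ B] {τ : A →L[ℝ] ℝ} {τ' : B →L[ℝ] ℝ} {φ : ℝ → ℝ}

theorem IsDiffeoGerm.fderiv_eq_of_comp_eq_time {Φ : OpenPartialHomeomorph A B} {a : A} {b : B}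
    (h : IsDiffeoGerm Φ a b) (hφ : τ' ∘ Φ =ᶠ[𝓝 a] φ ∘ τ) {x : A} (hx : τ x = 0) :
    τ' (fderiv ℝ Φ a x) = 0 := by
  have hline : HasDerivAt (fun r : ℝ => a + r • x) x 0 := by
    simpa using ((hasDerivAt_id (0 : ℝ)).smul_const x).const_add a
  have hderiv : HasDerivAt (fun r : ℝ => τ' (Φ (a + r • x))) (τ' (fderiv ℝ Φ a x)) 0 :=
    (τ'.hasFDerivAt.comp a h.isSmoothGerm.hasFDerivAt).comp_hasDerivAt_of_eq 0 hline (by simp)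
  have hconst : (fun r : ℝ => τ' (Φ (a + r • x))) =ᶠ[𝓝 0] fun _ => φ (τ a) := by
    have hcont : Tendsto (fun r : ℝ => a + r • x) (𝓝 0) (𝓝 a) := by
      simpa using hline.continuousAt.tendsto
    filter_upwards [hcont.eventually hφ] with r hr
    simpa [hx] using hr
  exact hderiv.unique ((hasDerivAt_const 0 _).congr_of_eventuallyEq hconst)

theorem IsDiffeoGerm.exists_fderiv_eq_of_comp_eq_time {Φ : OpenPartialHomeomorph A B} {a : A}
    {b : B} (h : IsDiffeoGerm Φ a b) (hφ : τ' ∘ Φ =ᶠ[𝓝 a] φ ∘ τ) (hτ' : τ' ≠ 0) {y : B}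
    (hy : τ' y = 0) : ∃ x, τ x = 0 ∧ fderiv ℝ Φ a x = y := by
  obtain ⟨y₁, hy₁⟩ : ∃ y₁, τ' y₁ ≠ 0 := by simpa using mt ContinuousLinearMap.ext hτ'
  obtain ⟨x₁, rfl⟩ := h.bijective_fderiv.2 y₁
  obtain ⟨x, rfl⟩ := h.bijective_fderiv.2 y
  refine ⟨x, by_contra fun hx => hy₁ ?_, rfl⟩
  -- `τ' ∘ fderiv ℝ Φ a` vanishes on the kernel of `τ` and at `x`, hence everywhere.
  have hker := h.fderiv_eq_of_comp_eq_time hφ (x := x₁ - (τ x₁ / τ x) • x) (by simp [hx])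
  simpa [hy] using hker

/-- `F` represents a smooth function germ at `a` with `F a = 0` whose restriction to the time slice
through `a`, a fibre of the time function `τ`, is a submersion. -/
structure IsSlicewiseSubmersionGerm (τ : A →L[ℝ] ℝ) (F : A → ℝ) (a : A) : Prop where
  smooth : IsSmoothGerm F a
  map_base : F a = 0
  submersion : ∃ x, τ x = 0 ∧ fderiv ℝ F a x ≠ 0

namespace IsSlicewiseSubmersionGerm

variable {F G : A → ℝ} {a : A}

theorem fderiv_ne_zero (hF : IsSlicewiseSubmersionGerm τ F a) : fderiv ℝ F a ≠ 0 := fun h => by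
  obtain ⟨x, -, hx⟩ := hF.submersion
  simp [h] at hx

theorem unit_mul (hF : IsSlicewiseSubmersionGerm τ F a) {l : A → ℝ} (hl : IsSmoothGerm l a)
    (hla : l a ≠ 0) : IsSlicewiseSubmersionGerm τ (l * F) a where
  smooth := hl.smul hF.smooth
  map_base := by simp [hF.map_base]
  submersion := by
    obtain ⟨x, hτx, hx⟩ := hF.submersion
    refine ⟨x, hτx, ?_⟩
    rw [fderiv_mul hl.differentiableAt hF.smooth.differentiableAt]
    simp [hF.map_base, hla, hx]

theorem comp_isDiffeoGerm {Φ : OpenPartialHomeomorph A B} {F : B → ℝ} {b : B}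
    (hF : IsSlicewiseSubmersionGerm τ' F b) (hΦ : IsDiffeoGerm Φ a b)
    (hφ : τ' ∘ Φ =ᶠ[𝓝 a] φ ∘ τ) (hτ' : τ' ≠ 0) : IsSlicewiseSubmersionGerm τ (F ∘ Φ) a where
  smooth := hΦ.isSmoothGerm_comp hF.smooth
  map_base := by rw [Function.comp_apply, hΦ.map_base, hF.map_base]
  submersion := by
    obtain ⟨y, hτy, hy⟩ := hF.submersion
    obtain ⟨x, hτx, rfl⟩ := hΦ.exists_fderiv_eq_of_comp_eq_time hφ hτ' hτy
    exact ⟨x, hτx, by rwa [hΦ.fderiv_comp hF.smooth]⟩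

theorem exists_eq_unit_mul [HasContDiffBump A] [CompleteSpace A]
    (hF : IsSlicewiseSubmersionGerm τ F a) (hG : IsSlicewiseSubmersionGerm τ G a)
    (hzero : ∀ᶠ z in 𝓝 a, F z = 0 → G z = 0) :
    ∃ μ : A → ℝ, IsSmoothGerm μ a ∧ μ a ≠ 0 ∧ ∀ᶠ z in 𝓝 a, G z = μ z * F z := by
  obtain ⟨μ, hμ, hμF⟩ :=
    hF.smooth.exists_eq_smul hG.smooth hF.map_base hF.fderiv_ne_zero hzero
  refine ⟨μ, hμ, fun hμa => hG.fderiv_ne_zero ?_, hμF.mono fun z hz => hz.trans (mul_comm _ _)⟩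
  have hG_eq : G =ᶠ[𝓝 a] F * μ := hμF
  rw [hG_eq.fderiv_eq, fderiv_mul hF.smooth.differentiableAt hμ.differentiableAt]
  simp [hF.map_base, hμa]

theorem exists_common_direction (hF : IsSlicewiseSubmersionGerm τ F a)
    (hG : IsSlicewiseSubmersionGerm τ G a) :
    ∃ e, τ e = 0 ∧ fderiv ℝ F a e ≠ 0 ∧ fderiv ℝ G a e ≠ 0 := by
  obtain ⟨e, he, hFG⟩ := Module.Dual.exists_forall_mem_ne_zero_of_forall_exists τ.toLinearMap.ker
    ![(fderiv ℝ F a).toLinearMap, (fderiv ℝ G a).toLinearMap]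
    (Fin.forall_fin_two.2 ⟨hF.submersion, hG.submersion⟩)
  exact ⟨e, he, hFG 0, hFG 1⟩

/-- The germ `Θ` is the quotient of the shears that straighten `F` and `G` along one direction. -/
theorem exists_isDiffeoGerm_comp_eq [CompleteSpace A] (hF : IsSlicewiseSubmersionGerm τ F a)
    (hG : IsSlicewiseSubmersionGerm τ G a) :
    ∃ Θ : OpenPartialHomeomorph A A, IsDiffeoGerm Θ a a ∧ τ ∘ Θ =ᶠ[𝓝 a] τ ∧
      G ∘ Θ =ᶠ[𝓝 a] F ∧ ∀ᶠ z in 𝓝 a, F z = G z ∨ F (Θ z) = G (Θ z) → Θ z = z := by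
  obtain ⟨e, hτe, hFe, hGe⟩ := hF.exists_common_direction hG
  obtain ⟨l, hl⟩ := SeparatingDual.exists_eq_one (R := ℝ) (x := e) (by rintro rfl; simp at hFe)
  obtain ⟨S, hS, hS_eq⟩ := hF.smooth.exists_shear hl hFe
  obtain ⟨T, hT, hT_eq⟩ := hG.smooth.exists_shear hl hGe
  rw [hF.map_base] at hS
  rw [hG.map_base] at hT
  have hΘ := hS.trans hT.symm
  set Θ := S.trans T.symm
  have hTΘ : ∀ᶠ z in 𝓝 a, T (Θ z) = S z := by
    filter_upwards [hΘ.eventually_mem_source] with z hz using T.right_inv hz.2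
  have hST {z} (hz : F z = G z) : S z = T z := by rw [hS_eq, hT_eq, hz]
  refine ⟨Θ, hΘ, ?_, ?_, ?_⟩
  · filter_upwards [hTΘ] with z hz
    simpa [hT_eq, hS_eq, hτe] using congrArg τ hz
  · filter_upwards [hTΘ] with z hz
    simpa [hT_eq, hS_eq, hl] using congrArg l hz
  · filter_upwards [hTΘ, hS.eventually_mem_source, hT.eventually_mem_source,
      hΘ.tendsto.eventually hS.eventually_mem_source,
      hΘ.tendsto.eventually hT.eventually_mem_source] with z hz hzS hzT hΘzS hΘzT
    rintro (h | h)
    · exact T.injOn hΘzT hzT (hz.trans (hST h))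
    · exact S.injOn hΘzS hzS ((hST h).trans hz)

end IsSlicewiseSubmersionGerm

/-- `Φ` represents a diffeomorphism germ that covers the map `φ` of time and maps the set germs
`(Y, a)` and `(Z, a)` onto `(Y', b)` and `(Z', b)`; the time functions of the two spaces are `τ`
and `τ'`. -/
structure IsContactGerm (τ : A → ℝ) (τ' : B → ℝ) (φ : ℝ → ℝ) (Φ : OpenPartialHomeomorph A B)
    (Y Z : Set A) (a : A) (Y' Z' : Set B) (b : B) : Prop extends IsDiffeoGerm Φ a b where
  time : τ' ∘ Φ =ᶠ[𝓝 a] φ ∘ τ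
  left : Y =ᶠ[𝓝 a] Φ ⁻¹' Y'
  right : Z =ᶠ[𝓝 a] Φ ⁻¹' Z'

namespace IsContactGerm

variable {C : Type*} [NormedAddCommGroup C] [NormedSpace ℝ C] {τ : A → ℝ} {τ' : B → ℝ}
  {τ'' : C → ℝ} {θ : ℝ → ℝ} {Φ : OpenPartialHomeomorph A B} {Θ : OpenPartialHomeomorph B C}
  {Y Z : Set A} {a : A} {Y' Z' : Set B} {b : B} {Y'' Z'' : Set C} {c : C}

theorem symm (h : IsContactGerm τ τ' id Φ Y Z a Y' Z' b) :
    IsContactGerm τ' τ id Φ.symm Y' Z' b Y Z a where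
  toIsDiffeoGerm := h.toIsDiffeoGerm.symm
  time := (h.eventuallyEq_comp_symm h.time.symm).symm
  left := h.eventuallyEq_comp_symm h.left
  right := h.eventuallyEq_comp_symm h.right

theorem trans (hΦ : IsContactGerm τ τ' φ Φ Y Z a Y' Z' b)
    (hΘ : IsContactGerm τ' τ'' θ Θ Y' Z' b Y'' Z'' c) :
    IsContactGerm τ τ'' (θ ∘ φ) (Φ.trans Θ) Y Z a Y'' Z'' c where
  toIsDiffeoGerm := hΦ.toIsDiffeoGerm.trans hΘ.toIsDiffeoGerm
  time := (hΘ.time.comp_tendsto hΦ.tendsto).trans (hΦ.time.fun_comp θ)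
  left := hΦ.left.trans (hΘ.left.comp_tendsto hΦ.tendsto)
  right := hΦ.right.trans (hΘ.right.comp_tendsto hΦ.tendsto)

end IsContactGerm

end Time

/-! ### Contact and `P`-`𝒦`-equivalence -/

section Contact

variable {E W : Type*} [NormedAddCommGroup E] [NormedSpace ℝ E] [NormedAddCommGroup W]
  [NormedSpace ℝ W]

theorem IsParamDiffeoGerm.isDiffeoGerm {Φ : OpenPartialHomeomorph (E × ℝ) (E × ℝ)} {a b : E × ℝ}
    (h : IsParamDiffeoGerm Φ a b) : IsDiffeoGerm Φ a b :=
  ⟨h.mem_source, h.map_base, h.smooth, h.smooth_symm⟩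

theorem IsDiffeoGerm.exists_isParamDiffeoGerm {Φ : OpenPartialHomeomorph (E × ℝ) (E × ℝ)}
    {a b : E × ℝ} {φ : ℝ → ℝ} (h : IsDiffeoGerm Φ a b)
    (hφ : Prod.snd ∘ Φ =ᶠ[𝓝 a] φ ∘ Prod.snd) :
    ∃ Φ' : OpenPartialHomeomorph (E × ℝ) (E × ℝ),
      IsParamDiffeoGerm Φ' a b ∧ (Φ' : E × ℝ → E × ℝ) = Φ := by
  obtain ⟨s, hs, hso, has⟩ := eventually_nhds_iff.1 hφ
  obtain ⟨hmem, hbase, hsmooth, hsymm⟩ := h.restrOpen hso has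
  exact ⟨Φ.restrOpen s hso, ⟨hmem, hbase, hsmooth, hsymm, φ, fun z hz => hs z hz.2⟩, rfl⟩

theorem sameContactType_iff_exists_isContactGerm {Y₁ Z₁ Y₂ Z₂ : Set (E × ℝ)} {a₁ a₂ : E × ℝ} :
    SameContactType Y₁ Z₁ a₁ Y₂ Z₂ a₂ ↔
      ∃ Φ φ, IsContactGerm Prod.snd Prod.snd φ Φ Y₁ Z₁ a₁ Y₂ Z₂ a₂ := by
  constructor
  · rintro ⟨Φ, hΦ, hY, hZ⟩
    obtain ⟨φ, hφ⟩ := hΦ.time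
    exact ⟨Φ, φ, hΦ.isDiffeoGerm, hΦ.isDiffeoGerm.eventually_mem_source.mono hφ,
      eventuallyEq_set.2 hY, eventuallyEq_set.2 hZ⟩
  · rintro ⟨Φ, φ, hΦ⟩
    obtain ⟨Φ', hΦ', hΦ'_eq⟩ := hΦ.exists_isParamDiffeoGerm hΦ.time
    refine ⟨Φ', hΦ', ?_, ?_⟩ <;> rw [hΦ'_eq]
    exacts [eventuallyEq_set.1 hΦ.left, eventuallyEq_set.1 hΦ.right]

theorem pkEquivalent_iff_exists_isDiffeoGerm {h₁ h₂ : E × ℝ → ℝ} {q₁ q₂ : E × ℝ} :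
    PKEquivalent h₁ q₁ h₂ q₂ ↔ ∃ Ψ φ l, IsDiffeoGerm Ψ q₁ q₂ ∧
      Prod.snd ∘ Ψ =ᶠ[𝓝 q₁] φ ∘ Prod.snd ∧ IsSmoothGerm l q₁ ∧ l q₁ ≠ 0 ∧
      h₂ ∘ Ψ =ᶠ[𝓝 q₁] l * h₁ := by
  constructor
  · rintro ⟨Ψ, l, hΨ, hl⟩
    obtain ⟨φ, hφ⟩ := hΨ.time
    exact ⟨Ψ, φ, l, hΨ.isDiffeoGerm, hΨ.isDiffeoGerm.eventually_mem_source.mono hφ, hl⟩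
  · rintro ⟨Ψ, φ, l, hΨ, hφ, hl⟩
    obtain ⟨Ψ', hΨ', hΨ'_eq⟩ := hΨ.exists_isParamDiffeoGerm hφ
    exact ⟨Ψ', l, hΨ', hΨ'_eq ▸ hl⟩

theorem snd_comp_fst_ne_zero :
    (ContinuousLinearMap.snd ℝ E ℝ).comp (.fst ℝ (E × ℝ) W) ≠ 0 := fun h => by
  simpa using DFunLike.congr_fun h ((0, 1), 0)

variable {A B : (E × ℝ) × W → ℝ} {q₁ q₂ : E × ℝ}

theorem IsContactGerm.pkEquivalent [CompleteSpace E] [CompleteSpace W]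
    [HasContDiffBump ((E × ℝ) × W)] {Ω : OpenPartialHomeomorph ((E × ℝ) × W) ((E × ℝ) × W)}
    {φ : ℝ → ℝ}
    (hΩ : IsContactGerm (fun z => z.1.2) (fun z => z.1.2) φ Ω
      {z | z.2 = 0} (A ⁻¹' {0}) (q₁, 0) {z | z.2 = 0} (B ⁻¹' {0}) (q₂, 0))
    (hA : IsSlicewiseSubmersionGerm (.comp (.snd ℝ E ℝ) (.fst ℝ (E × ℝ) W)) A (q₁, 0))
    (hB : IsSlicewiseSubmersionGerm (.comp (.snd ℝ E ℝ) (.fst ℝ (E × ℝ) W)) B (q₂, 0)) :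
    PKEquivalent (fun q => A (q, 0)) q₁ (fun q => B (q, 0)) q₂ := by
  have hinl : Tendsto (fun q : E × ℝ => (q, (0 : W))) (𝓝 q₁) (𝓝 (q₁, 0)) :=
    (Continuous.prodMk_left 0).tendsto q₁
  obtain ⟨Ψ, hΨ, hΨΩ⟩ := hΩ.exists_restrict hΩ.left
  obtain ⟨μ, hμ, hμ_ne, hμA⟩ :=
    hA.exists_eq_unit_mul (hB.comp_isDiffeoGerm hΩ.toIsDiffeoGerm hΩ.time snd_comp_fst_ne_zero)
      ((eventuallyEq_set.1 hΩ.right).mono fun _ => Iff.mp)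
  refine pkEquivalent_iff_exists_isDiffeoGerm.2 ⟨Ψ, φ, fun q => μ (q, 0), hΨ, ?_, ?_, hμ_ne, ?_⟩
  · filter_upwards [hΨΩ, hinl.eventually hΩ.time] with q hq hφ
    simpa [hq] using hφ
  · exact .comp hμ (.of_contDiff (contDiff_prodMk_left 0) q₁)
  · filter_upwards [hΨΩ, hinl.eventually hμA] with q hq hμq
    simpa [hq] using hμq

theorem PKEquivalent.exists_isContactGerm [CompleteSpace E] [CompleteSpace W]
    (h : PKEquivalent (fun q => A (q, 0)) q₁ (fun q => B (q, 0)) q₂)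
    (hA : IsSlicewiseSubmersionGerm (.comp (.snd ℝ E ℝ) (.fst ℝ (E × ℝ) W)) A (q₁, 0))
    (hB : IsSlicewiseSubmersionGerm (.comp (.snd ℝ E ℝ) (.fst ℝ (E × ℝ) W)) B (q₂, 0)) :
    ∃ Ω φ, IsContactGerm (fun z : (E × ℝ) × W => z.1.2) (fun z => z.1.2) φ Ω
      {z | z.2 = 0} (A ⁻¹' {0}) (q₁, 0) {z | z.2 = 0} (B ⁻¹' {0}) (q₂, 0) := by
  obtain ⟨Ψ, φ, l, hΨ, hφ, hl, hlq, hlh⟩ := pkEquivalent_iff_exists_isDiffeoGerm.1 h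
  have hfst : Tendsto Prod.fst (𝓝 (q₁, (0 : W))) (𝓝 q₁) := continuous_fst.tendsto _
  have hext := hΨ.prod_refl (0 : W)
  set Ω₀ := Ψ.prod (.refl W)
  have hΩ₀_time : (fun z => z.1.2) ∘ Ω₀ =ᶠ[𝓝 (q₁, 0)] φ ∘ fun z => z.1.2 := hφ.comp_tendsto hfst
  -- Both `l * A` and `B ∘ Ω₀` extend `l * h₁ = h₂ ∘ Ψ`.
  have hlA := hA.unit_mul (l := l ∘ Prod.fst) (.comp hl (.of_contDiff contDiff_fst _)) hlq
  obtain ⟨Θ, hΘ, hΘ_time, hΘ_comp, hΘ_fix⟩ := hlA.exists_isDiffeoGerm_comp_eq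
    (hB.comp_isDiffeoGerm hext hΩ₀_time snd_comp_fst_ne_zero)
  have hagree : ∀ᶠ z in 𝓝 (q₁, (0 : W)), z.2 = 0 → l z.1 * A z = B (Ω₀ z) := by
    filter_upwards [hfst.eventually hlh] with ⟨q, w⟩ hq
    rintro rfl
    exact hq.symm
  refine ⟨Θ.trans Ω₀, φ, hΘ.trans hext, ?_, eventuallyEq_set.2 ?_, eventuallyEq_set.2 ?_⟩
  · exact (hΩ₀_time.comp_tendsto hΘ.tendsto).trans (hΘ_time.fun_comp φ)
  · filter_upwards [hagree, hΘ.tendsto.eventually hagree, hΘ_fix] with z hz hΘz hfix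
    change z.2 = 0 ↔ (Θ z).2 = 0
    exact ⟨fun h => by rw [hfix (.inl (hz h)), h], fun h => by rw [← hfix (.inr (hΘz h)), h]⟩
  · have hl_ne : ∀ᶠ z in 𝓝 (q₁, (0 : W)), l z.1 ≠ 0 :=
      hfst.eventually (hl.continuousAt.eventually_ne hlq)
    filter_upwards [hΘ_comp, hl_ne] with z hz hlz
    have hBA : B (Ω₀ (Θ z)) = l z.1 * A z := hz
    change A z = 0 ↔ B (Ω₀ (Θ z)) = 0
    simp [hBA, hlz]

end Contact

/-! ### Straightening a family of immersions -/

section Straightening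

theorem exists_bijective_coprod_of_injective {K E V : Type*} [Field K] [AddCommGroup E]
    [Module K E] [AddCommGroup V] [Module K V] [FiniteDimensional K V] {D : E →ₗ[K] V}
    (hD : Function.Injective D) :
    ∃ j : (Fin (Module.finrank K V - Module.finrank K E) → K) →ₗ[K] V,
      Function.Bijective (D.coprod j) := by
  obtain ⟨C, hC⟩ := Submodule.exists_isCompl (LinearMap.range D)
  have hdim := Submodule.finrank_add_eq_of_isCompl hC
  rw [LinearMap.finrank_range_of_inj hD] at hdim
  let L : (Fin (Module.finrank K V - Module.finrank K E) → K) ≃ₗ[K] C :=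
    .ofFinrankEq _ _ (by rw [Module.finrank_fin_fun]; omega)
  let R := LinearEquiv.ofInjective D hD
  exact ⟨C.subtype ∘ₗ L, ((R.prodCongr L).trans (Submodule.prodEquivOfIsCompl _ _ hC)).bijective⟩

variable {E V W : Type*} [NormedAddCommGroup E] [NormedSpace ℝ E] [NormedAddCommGroup V]
  [NormedSpace ℝ V] [NormedAddCommGroup W] [NormedSpace ℝ W]

theorem bijective_prod_snd_coprod_inl {D : E × ℝ →L[ℝ] V} {j : W →L[ℝ] V}
    (h : Function.Bijective ((D.comp (.inl ℝ E ℝ)).coprod j)) :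
    Function.Bijective ((D.prod (.snd ℝ E ℝ)).coprod ((ContinuousLinearMap.inl ℝ V ℝ).comp j)) := by
  refine ⟨(injective_iff_map_eq_zero _).2 ?_, ?_⟩
  · rintro ⟨⟨u, t⟩, w⟩ huw
    obtain rfl : t = 0 := by simpa using congrArg Prod.snd huw
    have hzero : (u, w) = 0 := h.1 (by simpa [← Prod.zero_eq_mk] using congrArg Prod.fst huw)
    obtain ⟨rfl, rfl⟩ := Prod.mk.inj hzero
    rfl
  · rintro ⟨v, t⟩
    obtain ⟨⟨u, w⟩, huw⟩ := h.2 (v - D (0, t))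
    refine ⟨((u, t), w), Prod.ext ?_ (by simp)⟩
    have hsplit : D (u, t) = D (u, 0) + D (0, t) := by simp [← map_add]
    have huw : D (u, 0) + j w = v - D (0, t) := huw
    calc D (u, t) + j w = (D (u, 0) + j w) + D (0, t) := by rw [hsplit]; abel
      _ = v := by rw [huw, sub_add_cancel]

theorem IsSmoothGerm.exists_isDiffeoGerm_add [CompleteSpace E] [CompleteSpace V] [CompleteSpace W]
    {f : E → V} {a : E} (hf : IsSmoothGerm f a) (j : W →L[ℝ] V)
    (hj : Function.Bijective ((fderiv ℝ f a).coprod j)) :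
    ∃ Γ : OpenPartialHomeomorph (E × W) V, IsDiffeoGerm Γ (a, 0) (f a) ∧
      ∀ x w, Γ (x, w) = f x + j w := by
  have hsmooth : IsSmoothGerm (f ∘ Prod.fst + j ∘ Prod.snd) (a, (0 : W)) :=
    .add (.comp hf (.of_contDiff contDiff_fst _))
      (.of_contDiff (j.contDiff.comp contDiff_snd) _)
  have hderiv : HasFDerivAt (f ∘ Prod.fst + j ∘ Prod.snd) ((fderiv ℝ f a).coprod j) (a, (0 : W)) :=
    (hf.hasFDerivAt.comp (a, (0 : W)) hasFDerivAt_fst).add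
      (j.hasFDerivAt.comp (a, (0 : W)) hasFDerivAt_snd)
  obtain ⟨Γ, hΓ, hΓ_eq⟩ := hsmooth.exists_isDiffeoGerm (hderiv.fderiv ▸ hj)
  exact ⟨Γ, by simpa using hΓ, fun x w => by simp [hΓ_eq]⟩

theorem fderiv_comp_prodMk_left {g : E × ℝ → V} {q : E × ℝ} (hg : DifferentiableAt ℝ g q) :
    fderiv ℝ (fun u => g (u, q.2)) q.1 = (fderiv ℝ g q).comp (.inl ℝ E ℝ) :=
  (HasFDerivAt.comp q.1 (show HasFDerivAt g (fderiv ℝ g q) (q.1, q.2) from hg.hasFDerivAt)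
    (hasFDerivAt_prodMk_left q.1 q.2)).fderiv

/-- `g` represents a smooth germ at `q` that is an immersion in its first argument, and
`(u, t) ↦ (g (u, t), t)` is a homeomorphism from the neighbourhood `S` of `q` onto its image. -/
structure IsImmersedGraphAt (g : E × ℝ → V) (S : Set (E × ℝ)) (q : E × ℝ) : Prop where
  mem_nhds : S ∈ 𝓝 q
  smooth : IsSmoothGerm g q
  immersion : Function.Injective (fderiv ℝ (fun u => g (u, q.2)) q.1)
  embedding : IsEmbedding (S.domRestrict (graphMap g))

theorem IsImmersedGraphAt.eventually_mem_image_iff {g : E × ℝ → V} {S : Set (E × ℝ)} {q : E × ℝ}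
    (hg : IsImmersedGraphAt g S q) {Γ : OpenPartialHomeomorph ((E × ℝ) × W) (V × ℝ)}
    (hΓ : IsDiffeoGerm Γ (q, 0) (graphMap g q)) (hΓg : ∀ p, Γ (p, 0) = graphMap g p) :
    ∀ᶠ z in 𝓝 (q, (0 : W)), z.2 = 0 ↔ Γ z ∈ graphMap g '' S := by
  have hqS : q ∈ S := mem_of_mem_nhds hg.mem_nhds
  have hnear : ∀ᶠ y in 𝓝 (graphMap g q), ∀ p ∈ S, graphMap g p = y → (p, (0 : W)) ∈ Γ.source := by
    have hsource : ∀ᶠ p : S in 𝓝 ⟨q, hqS⟩, ((p : E × ℝ), (0 : W)) ∈ Γ.source :=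
      ((Continuous.prodMk_left 0).comp continuous_subtype_val).tendsto' _ _ rfl
        |>.eventually hΓ.eventually_mem_source
    rw [hg.embedding.nhds_eq_comap, eventually_comap] at hsource
    exact hsource.mono fun y hy p hp => hy ⟨p, hp⟩
  filter_upwards [hΓ.tendsto.eventually hnear, hΓ.eventually_mem_source,
    (continuous_fst.tendsto (q, (0 : W))).eventually hg.mem_nhds] with ⟨p, w⟩ hsource hz hpS
  constructor
  · rintro rfl
    exact ⟨p, hpS, (hΓg p).symm⟩
  · rintro ⟨p', hp', hp'z⟩
    have := Γ.injOn (hsource p' hp' hp'z) hz ((hΓg p').trans hp'z)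
    exact congrArg Prod.snd this.symm

theorem IsImmersedGraphAt.exists_isDiffeoGerm [FiniteDimensional ℝ E] [FiniteDimensional ℝ V]
    {g : E × ℝ → V} {S : Set (E × ℝ)} {q : E × ℝ} (hg : IsImmersedGraphAt g S q) :
    ∃ (Γ : OpenPartialHomeomorph
        ((E × ℝ) × (Fin (Module.finrank ℝ V - Module.finrank ℝ E) → ℝ)) (V × ℝ)),
      IsDiffeoGerm Γ (q, 0) (graphMap g q) ∧ (∀ z, (Γ z).2 = z.1.2) ∧
        ∀ p, Γ (p, 0) = graphMap g p := by
  have := FiniteDimensional.complete ℝ E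
  have := FiniteDimensional.complete ℝ V
  have hinj := hg.immersion
  rw [fderiv_comp_prodMk_left hg.smooth.differentiableAt] at hinj
  obtain ⟨j, hj⟩ := exists_bijective_coprod_of_injective
    (D := ((fderiv ℝ g q).comp (.inl ℝ E ℝ)).toLinearMap) hinj
  have hgraph : IsSmoothGerm (graphMap g) q := hg.smooth.prodMk (.of_contDiff contDiff_snd q)
  have hderiv : HasFDerivAt (graphMap g) ((fderiv ℝ g q).prod (.snd ℝ E ℝ)) q :=
    hg.smooth.hasFDerivAt.prodMk hasFDerivAt_snd
  obtain ⟨Γ, hΓ, hΓ_eq⟩ := hgraph.exists_isDiffeoGerm_add _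
    (hderiv.fderiv ▸ bijective_prod_snd_coprod_inl (j := j.toContinuousLinearMap) hj)
  exact ⟨Γ, hΓ, fun z => by simp [hΓ_eq z.1 z.2, graphMap], fun p => by simp [hΓ_eq]⟩

theorem IsImmersedGraphAt.exists_isContactGerm [FiniteDimensional ℝ E] [FiniteDimensional ℝ V]
    {g : E × ℝ → V} {S : Set (E × ℝ)} {q : E × ℝ} (hg : IsImmersedGraphAt g S q) {Z : Set (V × ℝ)}
    {F : V × ℝ → ℝ} (hF : IsSlicewiseSubmersionGerm (.snd ℝ V ℝ) F (graphMap g q))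
    (hZ : Z =ᶠ[𝓝 (graphMap g q)] F ⁻¹' {0}) :
    ∃ (Γ : OpenPartialHomeomorph
        ((E × ℝ) × (Fin (Module.finrank ℝ V - Module.finrank ℝ E) → ℝ)) (V × ℝ)),
      IsContactGerm (fun z => z.1.2) Prod.snd id Γ {z | z.2 = 0} (F ∘ Γ ⁻¹' {0}) (q, 0)
        (graphMap g '' S) Z (graphMap g q) ∧
      IsSlicewiseSubmersionGerm (.comp (.snd ℝ E ℝ) (.fst ℝ (E × ℝ) _)) (F ∘ Γ) (q, 0) ∧
      F ∘ graphMap g = fun p => (F ∘ Γ) (p, 0) := by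
  obtain ⟨Γ, hΓ, hΓ_time, hΓg⟩ := hg.exists_isDiffeoGerm
  refine ⟨Γ, ⟨hΓ, .of_forall hΓ_time, eventuallyEq_set.2 (hg.eventually_mem_image_iff hΓ hΓg),
    hZ.symm.comp_tendsto hΓ.tendsto⟩, ?_, funext fun p => congrArg F (hΓg p).symm⟩
  have hsnd : ContinuousLinearMap.snd ℝ V ℝ ≠ 0 := fun h => by
    simpa using DFunLike.congr_fun h (0, 1)
  exact hF.comp_isDiffeoGerm (φ := id) hΓ (.of_forall hΓ_time) hsnd

end Straightening

theorem proposition5p3_general {E V : Type*} [NormedAddCommGroup E] [NormedSpace ℝ E]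
    [FiniteDimensional ℝ E] [NormedAddCommGroup V] [NormedSpace ℝ V] [FiniteDimensional ℝ V]
    {g₁ g₂ : E × ℝ → V} {S₁ S₂ : Set (E × ℝ)} {q₁ q₂ : E × ℝ} {F₁ F₂ : V × ℝ → ℝ}
    {Z₁ Z₂ : Set (V × ℝ)} (hg₁ : IsImmersedGraphAt g₁ S₁ q₁) (hg₂ : IsImmersedGraphAt g₂ S₂ q₂)
    (hF₁ : IsSlicewiseSubmersionGerm (.snd ℝ V ℝ) F₁ (graphMap g₁ q₁))
    (hF₂ : IsSlicewiseSubmersionGerm (.snd ℝ V ℝ) F₂ (graphMap g₂ q₂))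
    (hZ₁ : Z₁ =ᶠ[𝓝 (graphMap g₁ q₁)] F₁ ⁻¹' {0}) (hZ₂ : Z₂ =ᶠ[𝓝 (graphMap g₂ q₂)] F₂ ⁻¹' {0}) :
    SameContactType (graphMap g₁ '' S₁) Z₁ (graphMap g₁ q₁)
        (graphMap g₂ '' S₂) Z₂ (graphMap g₂ q₂) ↔
      PKEquivalent (F₁ ∘ graphMap g₁) q₁ (F₂ ∘ graphMap g₂) q₂ := by
  have := FiniteDimensional.complete ℝ E
  obtain ⟨Γ₁, hΓ₁, hA, hA_eq⟩ := hg₁.exists_isContactGerm hF₁ hZ₁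
  obtain ⟨Γ₂, hΓ₂, hB, hB_eq⟩ := hg₂.exists_isContactGerm hF₂ hZ₂
  rw [sameContactType_iff_exists_isContactGerm, hA_eq, hB_eq]
  constructor
  · rintro ⟨Φ, φ, hΦ⟩
    exact ((hΓ₁.trans hΦ).trans hΓ₂.symm).pkEquivalent hA hB
  · intro h
    obtain ⟨Ω, φ, hΩ⟩ := h.exists_isContactGerm hA hB
    exact ⟨_, _, (hΓ₁.symm.trans hΩ).trans hΓ₂⟩

theorem IsSubmersionGerm.isSlicewiseSubmersionGerm {m : ℕ} {f : (Fin m → ℝ) → ℝ} {y : Fin m → ℝ}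
    (hf : IsSubmersionGerm f y) (t : ℝ) :
    IsSlicewiseSubmersionGerm (.snd ℝ (Fin m → ℝ) ℝ) (f ∘ Prod.fst) (y, t) where
  smooth := .comp hf.smooth (.of_contDiff contDiff_fst _)
  map_base := hf.map_base
  submersion := by
    obtain ⟨x, hx⟩ := hf.submersion 1
    have hderiv : HasFDerivAt (f ∘ Prod.fst) ((fderiv ℝ f y).comp (.fst ℝ (Fin m → ℝ) ℝ)) (y, t) :=
      hf.smooth.hasFDerivAt.comp (y, t) hasFDerivAt_fst
    exact ⟨(x, 0), rfl, by simp [hderiv.fderiv, hx]⟩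

theorem IsImmersedFamily.isImmersedGraphAt {r m : ℕ} {U : Set (Fin r → ℝ)} {I : Set ℝ}
    {g : (Fin r → ℝ) × ℝ → (Fin m → ℝ)} (hg : IsImmersedFamily U I g) {q : (Fin r → ℝ) × ℝ}
    (hq : q ∈ U ×ˢ I) : IsImmersedGraphAt g (U ×ˢ I) q where
  mem_nhds := (hg.isOpen_space.prod hg.isOpen_time).mem_nhds hq
  smooth := .of_contDiffOn hg.smooth (hg.isOpen_space.prod hg.isOpen_time) hq
  immersion := hg.immersion q.1 hq.1 q.2 hq.2
  embedding := hg.embedding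

theorem prod_eventuallyEq_preimage_fst {α β : Type*} [TopologicalSpace α] [TopologicalSpace β]
    (Z : Set α) {I : Set β} {z : α × β} (hI : I ∈ 𝓝 z.2) : Z ×ˢ I =ᶠ[𝓝 z] Prod.fst ⁻¹' Z :=
  eventuallyEq_set.2 <| (continuous_snd.continuousAt.eventually hI).mono fun _ => and_iff_left

theorem IsImmersedFamily.sameContactType_iff_pkEquivalent {r m : ℕ} {U₁ U₂ : Set (Fin r → ℝ)}
    {I₁ I₂ : Set ℝ} {g₁ g₂ : (Fin r → ℝ) × ℝ → (Fin m → ℝ)} {q₁ q₂ : (Fin r → ℝ) × ℝ}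
    {f₁ f₂ : (Fin m → ℝ) → ℝ} (hg₁ : IsImmersedFamily U₁ I₁ g₁) (hg₂ : IsImmersedFamily U₂ I₂ g₂)
    (hq₁ : q₁ ∈ U₁ ×ˢ I₁) (hq₂ : q₂ ∈ U₂ ×ˢ I₂)
    (hf₁ : IsSubmersionGerm f₁ (g₁ q₁)) (hf₂ : IsSubmersionGerm f₂ (g₂ q₂)) :
    SameContactType
        (graphMap g₁ '' (U₁ ×ˢ I₁)) ((f₁ ⁻¹' {0}) ×ˢ I₁) (g₁ q₁, q₁.2)
        (graphMap g₂ '' (U₂ ×ˢ I₂)) ((f₂ ⁻¹' {0}) ×ˢ I₂) (g₂ q₂, q₂.2) ↔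
      PKEquivalent (f₁ ∘ g₁) q₁ (f₂ ∘ g₂) q₂ :=
  proposition5p3_general (hg₁.isImmersedGraphAt hq₁) (hg₂.isImmersedGraphAt hq₂)
    (hf₁.isSlicewiseSubmersionGerm q₁.2) (hf₂.isSlicewiseSubmersionGerm q₂.2)
    (prod_eventuallyEq_preimage_fst _ (hg₁.isOpen_time.mem_nhds hq₁.2))
    (prod_eventuallyEq_preimage_fst _ (hg₂.isOpen_time.mem_nhds hq₂.2))

/-! ### World sheets -/

theorem IsWorldSheet.isImmersedFamily {s n : ℕ} {U : Set (Fin s → ℝ)} {I : Set ℝ}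
    {X : (Fin s → ℝ) × ℝ → (Fin (n + 1) → ℝ)} (hX : IsWorldSheet U I X) :
    IsImmersedFamily U I X where
  isOpen_space := hX.isOpen_space
  isOpen_time := hX.isOpen_time
  interval := hX.interval
  smooth := hX.smooth
  immersion u hu t ht := by
    have hq : (u, t) ∈ U ×ˢ I := ⟨hu, ht⟩
    have hX_smooth : IsSmoothGerm X (u, t) :=
      .of_contDiffOn hX.smooth (hX.isOpen_space.prod hX.isOpen_time) hq
    rw [fderiv_comp_prodMk_left (q := (u, t)) hX_smooth.differentiableAt]
    exact (hX.immersion _ hq).comp (Prod.mk_left_injective 0)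
  embedding := by
    have h : IsEmbedding (Prod.fst ∘ (U ×ˢ I).domRestrict (graphMap X)) := hX.embedding
    exact h.of_comp (hX.embedding.continuous.prodMk (continuous_snd.comp continuous_subtype_val))
      continuous_fst

section LightconeHeight

variable {s n : ℕ}

/-- The function `x ↦ ⟨x, ṽ⟩ - v₀`, whose composition with a world sheet is the extended lightcone
height function and whose zero set is `HP(ṽ, v₀)`. -/
noncomputable def lightconeHeight (v x : Fin (n + 1) → ℝ) : ℝ :=
  mink x (normalized v) - v 0

theorem eq_zero_of_forall_mink_eq_zero {y : Fin (n + 1) → ℝ} (h : ∀ x, mink x y = 0) : y = 0 := by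
  ext i
  refine Fin.cases ?_ (fun k => ?_) i
  · simpa [mink_comm timeVec, mink_self_timeVec] using h timeVec
  · simpa [mink, Pi.single_apply, Fin.succ_ne_zero, (Fin.succ_ne_zero _).symm]
      using h (Pi.single k.succ 1)

theorem isSubmersionGerm_lightconeHeight {v y : Fin (n + 1) → ℝ} (h : lightconeHeight v y = 0) :
    IsSubmersionGerm (lightconeHeight v) y := by
  let ℓ : (Fin (n + 1) → ℝ) →L[ℝ] ℝ := ((minkForm n).flip (normalized v)).toContinuousLinearMap
  have hderiv : HasFDerivAt (lightconeHeight v) ℓ y := ℓ.hasFDerivAt.sub_const (v 0)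
  refine ⟨.of_contDiff (ℓ.contDiff.sub contDiff_const) y, h, ?_⟩
  rw [hderiv.fderiv]
  refine LinearMap.surjective fun hℓ => one_ne_zero (α := ℝ) ?_
  exact congrFun (eq_zero_of_forall_mink_eq_zero (DFunLike.congr_fun hℓ)) 0

variable {X : (Fin s → ℝ) × ℝ → (Fin (n + 1) → ℝ)} {q : (Fin s → ℝ) × ℝ} {ξ : Fin (n + 1) → ℝ}

theorem lightconePedal_zero : lightconePedal X q ξ 0 = mink (X q) (lightconeGauss X q ξ) :=
  mul_one _

theorem normalized_lightconePedal (h : lightconePedal X q ξ 0 ≠ 0) :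
    normalized (lightconePedal X q ξ) = lightconeGauss X q ξ := by
  rw [lightconePedal_zero] at h
  ext i
  refine Fin.cases rfl (fun k => ?_) i
  rw [normalized, Fin.cons_succ, lightconePedal_zero]
  exact mul_div_cancel_left₀ _ h

theorem lightconeHeight_lightconePedal (h : lightconePedal X q ξ 0 ≠ 0) :
    lightconeHeight (lightconePedal X q ξ) (X q) = 0 := by
  rw [lightconeHeight, normalized_lightconePedal h, lightconePedal_zero, sub_self]

variable (X q ξ) in
theorem tangentLightlikeHyperplane_eq_preimage :
    tangentLightlikeHyperplane X q ξ = lightconeHeight (lightconePedal X q ξ) ⁻¹' {0} :=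
  Set.ext fun _ => sub_eq_zero.symm

end LightconeHeight

theorem proposition5p3 (s n : ℕ) :
    -- the parametric version of Montaldi's theorem
    (∀ (U₁ U₂ : Set (Fin s → ℝ)) (I₁ I₂ : Set ℝ)
      (g₁ g₂ : (Fin s → ℝ) × ℝ → (Fin n → ℝ)) (q₁ q₂ : (Fin s → ℝ) × ℝ)
      (f₁ f₂ : (Fin n → ℝ) → ℝ),
      IsImmersedFamily U₁ I₁ g₁ → IsImmersedFamily U₂ I₂ g₂ →
      q₁ ∈ U₁ ×ˢ I₁ → q₂ ∈ U₂ ×ˢ I₂ →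
      IsSubmersionGerm f₁ (g₁ q₁) → IsSubmersionGerm f₂ (g₂ q₂) →
      (SameContactType
          (graphMap g₁ '' (U₁ ×ˢ I₁)) ((f₁ ⁻¹' {0}) ×ˢ I₁) (g₁ q₁, q₁.2)
          (graphMap g₂ '' (U₂ ×ˢ I₂)) ((f₂ ⁻¹' {0}) ×ˢ I₂) (g₂ q₂, q₂.2) ↔
        PKEquivalent (f₁ ∘ g₁) q₁ (f₂ ∘ g₂) q₂)) ∧
    -- the statement on world sheets
    (∀ (U₁ U₂ : Set (Fin s → ℝ)) (I₁ I₂ : Set ℝ)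
      (X₁ X₂ : (Fin s → ℝ) × ℝ → (Fin (n + 1) → ℝ)) (q₁ q₂ : (Fin s → ℝ) × ℝ)
      (ξ₁ ξ₂ v₁ v₂ : Fin (n + 1) → ℝ),
      IsWorldSheet U₁ I₁ X₁ → IsWorldSheet U₂ I₂ X₂ →
      q₁ ∈ U₁ ×ˢ I₁ → q₂ ∈ U₂ ×ˢ I₂ →
      ξ₁ ∈ unitNormals X₁ q₁ → ξ₂ ∈ unitNormals X₂ q₂ →
      v₁ = lightconePedal X₁ q₁ ξ₁ → v₂ = lightconePedal X₂ q₂ ξ₂ →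
      v₁ ∈ lightcone n → v₂ ∈ lightcone n →
      (SameContactType
          (graphMap X₁ '' (U₁ ×ˢ I₁)) (tangentLightlikeHyperplane X₁ q₁ ξ₁ ×ˢ I₁) (X₁ q₁, q₁.2)
          (graphMap X₂ '' (U₂ ×ˢ I₂)) (tangentLightlikeHyperplane X₂ q₂ ξ₂ ×ˢ I₂) (X₂ q₂, q₂.2) ↔
        PKEquivalent (extendedHeight X₁ v₁) q₁ (extendedHeight X₂ v₂) q₂)) := by
  refine ⟨fun U₁ U₂ I₁ I₂ g₁ g₂ q₁ q₂ f₁ f₂ hg₁ hg₂ => hg₁.sameContactType_iff_pkEquivalent hg₂, ?_⟩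
  rintro U₁ U₂ I₁ I₂ X₁ X₂ q₁ q₂ ξ₁ ξ₂ _ _ hX₁ hX₂ hq₁ hq₂ - - rfl rfl hv₁ hv₂
  rw [tangentLightlikeHyperplane_eq_preimage, tangentLightlikeHyperplane_eq_preimage]
  exact hX₁.isImmersedFamily.sameContactType_iff_pkEquivalent hX₂.isImmersedFamily hq₁ hq₂
    (isSubmersionGerm_lightconeHeight (lightconeHeight_lightconePedal hv₁.1))
    (isSubmersionGerm_lightconeHeight (lightconeHeight_lightconePedal hv₂.1))
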